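/- Let $n\ge 1$, $0<\alpha<2$ and $1<p\le q<\infty$. Write $\mathbb{R}^{n+1}_+=\mathbb{R}^n\times(0,\infty)$ and let $\mu$ be a nonnegative Radon measure on $\mathbb{R}^{n+1}_+$. For $f\in L^p(\mathbb{R}^n)$ (real-valued) let $$P_\alpha f(x,t)=c(n,\alpha)\int_{\mathbb{R}^n}\frac{t^\alpha f(y)}{(|x-y|^2+t^2)^{(n+\alpha)/2}}\,dy,\qquad c(n,\alpha)=\frac{\Gamma((n+\alpha)/2)}{\pi^{n/2}\Gamma(\alpha/2)},$$ be its Caffarelli–Silvestre extension. For $E\subseteq\mathbb{R}^{n+1}_+$ define the capacity $$C^{\alpha,p}(E)=\inf\left\{\|f\|_{L^p(\mathbb{R}^n)}^p:\ f\in L^p(\mathbb{R}^n),\ f\ge 0,\ P_\alpha f(x,t)\ge 1\ \text{for all }(x,t)\in E\right\},$$ with $C^{\alpha,p}(E)=0$ if there is no such $f$ (this does not occur for compact $E$), and for $\lambda>0$ $$c_{\alpha,p}(\mu;\lambda)=\inf\left\{C^{\alpha,p}(K):\ K\subset\mathbb{R}^{n+1}_+\ \text{compact},\ \mu(K)\ge\lambda\right\}\in[0,\infty],$$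 where $\inf\varnothing=\infty$. For $r>0$, $x_0\in\mathbb{R}^n$, $t_0>0$ let $$B_r(x_0,t_0)=\left\{(x,t)\in\mathbb{R}^{n+1}_+:\ |x-x_0|<r/2,\ r<t-t_0<2r\right\}.$$ (i) There is a constant $C<\infty$ such that $$\|P_\alpha f\|_{L^q(\mathbb{R}^{n+1}_+,\mu)}\le C\,\|f\|_{L^p(\mathbb{R}^n)}\quad\text{for all } f\in L^p(\mathbb{R}^n)\qquad(*)$$ if and only if $$\sup_{\lambda\in(0,\infty)}\frac{\lambda^{p/q}}{c_{\alpha,p}(\mu;\lambda)}<\infty ,$$ where the quotient is $0$ if $c_{\alpha,p}(\mu;\lambda)=\infty$ and $\infty$ if $c_{\alpha,p}(\mu;\lambda)=0$. (ii) If $p<q$, then for every fixed $\kappa>0$, $(*)$ holds for some $C<\infty$ if and only if $$\sup\left\{\frac{\mu(B_r(x_0,t_0))}{r^{qn/p}}:\ r>0,\ x_0\in\mathbb{R}^n,\ 0<t_0\le\kappa r\right\}<\infty .$$ -/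

import Mathlib

open MeasureTheory
open scoped ENNReal

noncomputable section

namespace CaffarelliSilvestre

/-- The upper half-space `ℝⁿ × (0, ∞)`, where `ℝⁿ` carries the Euclidean norm. -/
abbrev UpperHalfSpace (n : ℕ) : Type :=
  EuclideanSpace ℝ (Fin n) × Set.Ioi (0 : ℝ)

/-- The normalising constant `c(n, α) = Γ((n + α) / 2) / (π ^ (n / 2) Γ(α / 2))`. -/
def kernelConst (n : ℕ) (α : ℝ) : ℝ :=
  Real.Gamma (((n : ℝ) + α) / 2) / (Real.pi ^ ((n : ℝ) / 2) * Real.Gamma (α / 2))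

/-- The Poisson kernel `p_t^α(x) = c(n, α) t ^ α / (|x|² + t²) ^ ((n + α) / 2)`. -/
def poissonKernel {n : ℕ} (α t : ℝ) (x : EuclideanSpace ℝ (Fin n)) : ℝ :=
  kernelConst n α * t ^ α / (‖x‖ ^ 2 + t ^ 2) ^ (((n : ℝ) + α) / 2)

/-- The Caffarelli–Silvestre extension `P_α f (x, t) = ∫ p_t^α(x - y) f(y) dy`. The integral
converges absolutely at every point of the half-space when `f ∈ L^p(ℝⁿ)`, `1 ≤ p < ∞`. -/
def extension {n : ℕ} (α : ℝ) (f : EuclideanSpace ℝ (Fin n) → ℝ) (z : UpperHalfSpace n) : ℝ :=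
  ∫ y, poissonKernel α (z.2 : ℝ) (z.1 - y) * f y

/-- The embedding `‖P_α f‖_{L^q(μ)} ≲ ‖f‖_{L^p(ℝⁿ)}` for all `f ∈ L^p(ℝⁿ)`. -/
def Embedding {n : ℕ} (α p q : ℝ) (μ : Measure (UpperHalfSpace n)) : Prop :=
  ∃ C : NNReal, ∀ f : EuclideanSpace ℝ (Fin n) → ℝ, MemLp f (ENNReal.ofReal p) volume →
    eLpNorm (extension α f) (ENNReal.ofReal q) μ ≤ C * eLpNorm f (ENNReal.ofReal p) volume

/-- The functions competing in the definition of the capacity of `E`: nonnegative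
`f ∈ L^p(ℝⁿ)` with `P_α f ≥ 1` everywhere on `E`. -/
def admissible {n : ℕ} (α p : ℝ) (E : Set (UpperHalfSpace n)) :
    Set (EuclideanSpace ℝ (Fin n) → ℝ) :=
  {f | MemLp f (ENNReal.ofReal p) volume ∧ (∀ y, 0 ≤ f y) ∧ ∀ z ∈ E, 1 ≤ extension α f z}

open Classical in
/-- The Caffarelli–Silvestre `L^p`-capacity: the infimum of `‖f‖_p ^ p` over the admissible
functions, and `0` by convention if there is none (which never happens for compact `E`). -/
def capacity {n : ℕ} (α p : ℝ) (E : Set (UpperHalfSpace n)) : ℝ≥0∞ :=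
  if (admissible α p E).Nonempty then
    ⨅ f ∈ admissible α p E, eLpNorm f (ENNReal.ofReal p) volume ^ p
  else 0

/-- The capacity minimising function `c_{α,p}(μ; l)`, the infimum of the capacities of the
compact sets `K` with `μ(K) ≥ l` (equal to `∞` if there is no such `K`). -/
def capacityMin {n : ℕ} (α p : ℝ) (μ : Measure (UpperHalfSpace n)) (l : ℝ) : ℝ≥0∞ :=
  ⨅ (K : Set (UpperHalfSpace n)) (_ : IsCompact K) (_ : ENNReal.ofReal l ≤ μ K), capacity α p K

/-- The ball `B_r(x₀, t₀) = {(x, t) : |x - x₀| < r / 2, r < t - t₀ < 2 r}` of the half-space. -/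
def halfSpaceBall {n : ℕ} (r : ℝ) (x₀ : EuclideanSpace ℝ (Fin n)) (t₀ : ℝ) :
    Set (UpperHalfSpace n) :=
  {z | ‖z.1 - x₀‖ < r / 2 ∧ r < (z.2 : ℝ) - t₀ ∧ (z.2 : ℝ) - t₀ < 2 * r}

/-- The supremum over `l ∈ (0, ∞)` of `l ^ (p / q) / c_{α,p}(μ; l)`. -/
def capacityRatioSup {n : ℕ} (α p q : ℝ) (μ : Measure (UpperHalfSpace n)) : ℝ≥0∞ :=
  ⨆ (l : ℝ) (_ : 0 < l), ENNReal.ofReal (l ^ (p / q)) / capacityMin α p μ l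

/-- The supremum of `μ(B_r(x₀, t₀)) / r ^ (q n / p)` over `r > 0` and `(x₀, t₀)` in the
half-space with `t₀ ≤ κ r`. -/
def ballRatioSup {n : ℕ} (p q κ : ℝ) (μ : Measure (UpperHalfSpace n)) : ℝ≥0∞ :=
  ⨆ (r : ℝ) (x₀ : EuclideanSpace ℝ (Fin n)) (t₀ : ℝ) (_ : 0 < r) (_ : 0 < t₀) (_ : t₀ ≤ κ * r),
    μ (halfSpaceBall r x₀ t₀) / ENNReal.ofReal (r ^ (q * (n : ℝ) / p))

end CaffarelliSilvestre

end

noncomputable section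

namespace CaffarelliSilvestre

variable {n : ℕ} {α : ℝ}

/-! Everything passes through one geometric condition, `ShadowBound`: μ(K) ≤ A |S(K)|^(q/p) for all
compact K, where the shadow S(K) ⊆ ℝⁿ is the union of the balls B(x, t) over (x, t) ∈ K.

Shadows fit the extension in two ways. The kernel is at least a constant times t^(-n) on B(x, t), so
a multiple of the indicator of S(K) is admissible for K and the capacity of K is at most C |S(K)|
(`exists_capacity_le`). Conversely, P_α g(x, t) is controlled by averages of g over balls about x of
radius at least t. A Vitali covering therefore bounds the whole shadow of a level set {P_α g > l},
as for the maximal function: this gives a weak (p, p) bound (`exists_volume_shadow_le_rpow`) and,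
after truncation, its strong integrated form (`exists_lintegral_volume_shadow_le`).

The embedding gives the capacity condition by Chebyshev's inequality applied to admissible f, and
the capacity condition gives the shadow bound on taking λ = μ(K). The shadow bound gives the
embedding (`ShadowBound.embedding`): in the layer-cake formula for ‖P_α f‖_q^q, the shadow volume V
of the level l enters as V^(q/p) = V · V^(q/p - 1). The second factor is estimated by the weak
bound, and the strong bound integrates the rest.

For p < q, testing on the indicator of a ball gives the ball condition. For the converse, K is cut
into layers of geometrically decreasing height. Fubini and the ball condition bound the mass of a
layer of height about r by |S(K)| r^γ with γ = n(q/p - 1) > 0. The heights are at most C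
|S(K)|^(1/n), so the geometric series sums to the shadow bound. -/

/-- The union of the balls `B(x, t)` over the points `(x, t)` of `E`. -/
def shadow (E : Set (UpperHalfSpace n)) : Set (EuclideanSpace ℝ (Fin n)) :=
  ⋃ z ∈ E, Metric.ball z.1 (z.2 : ℝ)

/-- The extension of a nonnegative function, as a Lebesgue integral with values in `[0, ∞]`. -/
def lextension (α : ℝ) (g : EuclideanSpace ℝ (Fin n) → ℝ≥0∞) (z : UpperHalfSpace n) : ℝ≥0∞ :=
  ∫⁻ y, ENNReal.ofReal (poissonKernel α (z.2 : ℝ) (z.1 - y)) * g y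

/-! ### Shadows, positivity and measurability of the extension -/

theorem isOpen_shadow (E : Set (UpperHalfSpace n)) : IsOpen (shadow E) :=
  isOpen_biUnion fun _ _ => Metric.isOpen_ball

theorem shadow_mono {E F : Set (UpperHalfSpace n)} (h : E ⊆ F) : shadow E ⊆ shadow F :=
  Set.biUnion_subset_biUnion_left h

theorem ball_subset_shadow {E : Set (UpperHalfSpace n)} {z : UpperHalfSpace n} (hz : z ∈ E) :
    Metric.ball z.1 (z.2 : ℝ) ⊆ shadow E :=
  Set.subset_biUnion_of_mem (u := fun z : UpperHalfSpace n => Metric.ball z.1 (z.2 : ℝ)) hz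

theorem volume_shadow_ne_top {K : Set (UpperHalfSpace n)} (hK : IsCompact K) :
    volume (shadow K) ≠ ∞ := by
  obtain ⟨a, ha⟩ := (hK.image continuous_fst).isBounded.exists_norm_le
  obtain ⟨b, hb⟩ := (hK.image (continuous_subtype_val.comp continuous_snd)).isBounded.exists_norm_le
  have hsub : shadow K ⊆ Metric.ball 0 (a + b) := by
    intro y hy
    simp only [shadow, Set.mem_iUnion, exists_prop] at hy
    obtain ⟨z, hz, hy⟩ := hy
    have h1 := ha z.1 ⟨z, hz, rfl⟩
    have h2 := (le_abs_self _).trans (hb (z.2 : ℝ) ⟨z, hz, rfl⟩)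
    rw [Metric.mem_ball, dist_eq_norm] at hy
    rw [mem_ball_zero_iff]
    calc ‖y‖ = ‖(y - z.1) + z.1‖ := by simp
      _ ≤ ‖y - z.1‖ + ‖z.1‖ := norm_add_le _ _
      _ < a + b := by linarith
  exact ((measure_mono hsub).trans_lt measure_ball_lt_top).ne

theorem kernelConst_pos (n : ℕ) (hα : 0 < α) : 0 < kernelConst n α := by
  unfold kernelConst
  have h1 : 0 < Real.Gamma (((n : ℝ) + α) / 2) := Real.Gamma_pos_of_pos (by positivity)
  have h2 : 0 < Real.Gamma (α / 2) := Real.Gamma_pos_of_pos (by positivity)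
  have := Real.pi_pos
  positivity

theorem poissonKernel_nonneg (hα : 0 < α) {t : ℝ} (ht : 0 < t) (x : EuclideanSpace ℝ (Fin n)) :
    0 ≤ poissonKernel α t x := by
  have := kernelConst_pos n hα
  unfold poissonKernel
  positivity

theorem measurable_poissonKernel (α : ℝ) :
    Measurable fun w : UpperHalfSpace n × EuclideanSpace ℝ (Fin n) =>
      poissonKernel α (w.1.2 : ℝ) (w.1.1 - w.2) := by
  unfold poissonKernel
  fun_prop

theorem measurable_lextension {g : EuclideanSpace ℝ (Fin n) → ℝ≥0∞} (hg : Measurable g) :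
    Measurable (lextension α g) := by
  have h : Measurable fun w : UpperHalfSpace n × EuclideanSpace ℝ (Fin n) =>
      ENNReal.ofReal (poissonKernel α (w.1.2 : ℝ) (w.1.1 - w.2)) * g w.2 :=
    (measurable_poissonKernel α).ennreal_ofReal.mul (hg.comp measurable_snd)
  exact h.lintegral_prod_right'

theorem stronglyMeasurable_extension {f : EuclideanSpace ℝ (Fin n) → ℝ}
    (hf : StronglyMeasurable f) : StronglyMeasurable (extension α f) := by
  have h : StronglyMeasurable fun w : UpperHalfSpace n × EuclideanSpace ℝ (Fin n) =>
      poissonKernel α (w.1.2 : ℝ) (w.1.1 - w.2) * f w.2 :=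
    ((measurable_poissonKernel α).mul (hf.measurable.comp measurable_snd)).stronglyMeasurable
  exact h.integral_prod_right

theorem extension_congr_ae {f g : EuclideanSpace ℝ (Fin n) → ℝ} (h : f =ᵐ[volume] g) :
    extension α f = extension α g := by
  funext z
  refine integral_congr_ae ?_
  filter_upwards [h] with y hy
  rw [hy]

theorem enorm_extension_le (hα : 0 < α) (f : EuclideanSpace ℝ (Fin n) → ℝ)
    (z : UpperHalfSpace n) : ‖extension α f z‖ₑ ≤ lextension α (fun y => ‖f y‖ₑ) z := by
  refine (enorm_integral_le_lintegral_enorm _).trans (lintegral_mono fun y => ?_)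
  rw [enorm_mul, Real.enorm_of_nonneg (poissonKernel_nonneg hα z.2.2 _)]

/-! ### Dyadic domination of the kernel by balls of radius at least t -/

/-- The value at `(x, t)` of the dyadic majorant of the Poisson kernel on `B(x, 2 ^ k t)`. -/
def dyadicWeight (n : ℕ) (α t : ℝ) (k : ℕ) : ℝ :=
  kernelConst n α * t ^ α / (2 ^ k * t / 2) ^ ((n : ℝ) + α)

/-- Take the least k with |x| ≤ 2^k t. Either k = 0, where t alone bounds the denominator below, or
|x| > 2^(k-1) t by minimality; this is the origin of the halving in `dyadicWeight`. -/
theorem poissonKernel_le_dyadicWeight (hα : 0 < α) {t : ℝ} (ht : 0 < t)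
    (x : EuclideanSpace ℝ (Fin n)) :
    ∃ k : ℕ, ‖x‖ ≤ 2 ^ k * t ∧ poissonKernel α t x ≤ dyadicWeight n α t k := by
  have hex : ∃ k : ℕ, ‖x‖ ≤ 2 ^ k * t := by
    obtain ⟨k, hk⟩ := pow_unbounded_of_one_lt (‖x‖ / t) (one_lt_two (α := ℝ))
    exact ⟨k, ((div_lt_iff₀ ht).1 hk).le⟩
  classical
  refine ⟨Nat.find hex, Nat.find_spec hex, ?_⟩
  have key : (2 ^ Nat.find hex * t / 2) ^ 2 ≤ ‖x‖ ^ 2 + t ^ 2 := by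
    rcases hk : Nat.find hex with _ | j
    · nlinarith [sq_nonneg ‖x‖]
    · have hj : ¬ ‖x‖ ≤ 2 ^ j * t := Nat.find_min hex (by omega)
      have h0 : 0 ≤ 2 ^ j * t := by positivity
      have h1 : (2 ^ j * t) ^ 2 ≤ ‖x‖ ^ 2 := pow_le_pow_left₀ h0 (not_le.1 hj).le 2
      have h2 : (2 : ℝ) ^ (j + 1) * t / 2 = 2 ^ j * t := by ring
      rw [h2]
      nlinarith
  have hpos : 0 < 2 ^ Nat.find hex * t / 2 := by positivity
  have hk := kernelConst_pos n hα
  unfold poissonKernel dyadicWeight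
  refine div_le_div_of_nonneg_left (by positivity) (by positivity) ?_
  calc (2 ^ Nat.find hex * t / 2) ^ ((n : ℝ) + α)
      = ((2 ^ Nat.find hex * t / 2) ^ 2) ^ (((n : ℝ) + α) / 2) := by
        rw [← Real.rpow_natCast (2 ^ Nat.find hex * t / 2) 2, ← Real.rpow_mul hpos.le]
        congr 1
        push_cast
        ring
    _ ≤ _ := Real.rpow_le_rpow (by positivity) key (by positivity)

/-- The mass of the k-th majorant decays like 2^(-αk), independently of t; with α > 0 this makes the
dyadic sum converge. -/
theorem dyadicWeight_mul_pow {t : ℝ} (ht : 0 < t) (k : ℕ) :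
    dyadicWeight n α t k * (2 ^ k * t) ^ n =
      kernelConst n α * 2 ^ ((n : ℝ) + α) * ((2 : ℝ) ^ (-α)) ^ k := by
  unfold dyadicWeight
  have h2 : (0 : ℝ) < 2 ^ k := by positivity
  rw [Real.div_rpow (by positivity) (by norm_num), Real.mul_rpow h2.le ht.le,
    Real.rpow_add ht, Real.rpow_add h2, Real.rpow_natCast, Real.rpow_natCast, mul_pow,
    Real.rpow_neg (by norm_num), inv_pow]
  have h3 : ((2 : ℝ) ^ α) ^ k = (2 ^ k) ^ α := by
    rw [← Real.rpow_natCast, ← Real.rpow_natCast, ← Real.rpow_mul (by norm_num),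
      ← Real.rpow_mul (by norm_num), mul_comm]
  rw [h3]
  have h4 : 0 < t ^ α := by positivity
  field_simp

/-- The kernel is dominated by a summable combination of normalised indicators of balls B(x, 2^k t).
Only radii R ≥ t occur, which is what later allows a covering argument to capture all of B(x, t). -/
theorem exists_lextension_le (n : ℕ) (hα : 0 < α) :
    ∃ C : ℝ, 0 < C ∧ ∀ (g : EuclideanSpace ℝ (Fin n) → ℝ≥0∞), Measurable g →
      ∀ (z : UpperHalfSpace n) (M : ℝ≥0∞),
      (∀ R : ℝ, (z.2 : ℝ) ≤ R →
        ∫⁻ y in Metric.closedBall z.1 R, g y ≤ M * ENNReal.ofReal (R ^ n)) →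
      lextension α g z ≤ ENNReal.ofReal C * M := by
  have hK := kernelConst_pos n hα
  set D : ℝ := kernelConst n α * 2 ^ ((n : ℝ) + α) with hD
  have hDpos : 0 < D := by positivity
  have hr1 : (2 : ℝ) ^ (-α) < 1 := Real.rpow_lt_one_of_one_lt_of_neg one_lt_two (by linarith)
  have hr0 : (0 : ℝ) ≤ 2 ^ (-α) := by positivity
  have hsum := summable_geometric_of_lt_one hr0 hr1
  refine ⟨D * (1 - 2 ^ (-α))⁻¹, mul_pos hDpos (inv_pos.2 (by linarith)), ?_⟩
  intro g hg z M h
  have ht : 0 < (z.2 : ℝ) := z.2.2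
  calc lextension α g z
      ≤ ∫⁻ y, ∑' k : ℕ, ENNReal.ofReal (dyadicWeight n α z.2 k) *
          (Metric.closedBall z.1 (2 ^ k * (z.2 : ℝ))).indicator g y := by
        refine lintegral_mono fun y => ?_
        obtain ⟨k, hk, hle⟩ := poissonKernel_le_dyadicWeight hα ht (z.1 - y)
        refine le_trans ?_ (ENNReal.le_tsum k)
        have hy : y ∈ Metric.closedBall z.1 (2 ^ k * (z.2 : ℝ)) := by
          rwa [Metric.mem_closedBall, dist_comm, dist_eq_norm]
        rw [Set.indicator_of_mem hy]
        gcongr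
    _ = ∑' k : ℕ, ENNReal.ofReal (dyadicWeight n α z.2 k) *
          ∫⁻ y in Metric.closedBall z.1 (2 ^ k * (z.2 : ℝ)), g y := by
        rw [lintegral_tsum fun k =>
          ((hg.indicator Metric.isClosed_closedBall.measurableSet).const_mul _).aemeasurable]
        refine tsum_congr fun k => ?_
        rw [lintegral_const_mul _ (hg.indicator Metric.isClosed_closedBall.measurableSet),
          lintegral_indicator Metric.isClosed_closedBall.measurableSet]
    _ ≤ ∑' k : ℕ, ENNReal.ofReal (D * ((2 : ℝ) ^ (-α)) ^ k) * M := by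
        refine ENNReal.tsum_le_tsum fun k => ?_
        have h1 : (z.2 : ℝ) ≤ 2 ^ k * (z.2 : ℝ) :=
          le_mul_of_one_le_left ht.le (one_le_pow₀ one_le_two)
        have h2 : 0 ≤ dyadicWeight n α z.2 k := by unfold dyadicWeight; positivity
        calc _ ≤ ENNReal.ofReal (dyadicWeight n α z.2 k) *
              (M * ENNReal.ofReal ((2 ^ k * (z.2 : ℝ)) ^ n)) := by gcongr; exact h _ h1
          _ = _ := by
            rw [hD, ← dyadicWeight_mul_pow ht, ENNReal.ofReal_mul h2]
            ring
    _ = _ := by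
        rw [ENNReal.tsum_mul_right, ← ENNReal.ofReal_tsum_of_nonneg (fun k => by positivity)
          (hsum.mul_left D), tsum_mul_left, tsum_geometric_of_lt_one hr0 hr1]

/-! ### Volumes of balls, and the extension of constants and indicators -/

theorem volume_closedBall_eq (x : EuclideanSpace ℝ (Fin n)) {r : ℝ} (hr : 0 ≤ r) :
    volume (Metric.closedBall x r) =
      ENNReal.ofReal (r ^ n) * volume (Metric.ball (0 : EuclideanSpace ℝ (Fin n)) 1) := by
  simpa using Measure.addHaar_closedBall (volume : Measure (EuclideanSpace ℝ (Fin n))) x hr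

theorem volume_ball_eq (x : EuclideanSpace ℝ (Fin n)) {r : ℝ} (hr : 0 < r) :
    volume (Metric.ball x r) =
      ENNReal.ofReal (r ^ n) * volume (Metric.ball (0 : EuclideanSpace ℝ (Fin n)) 1) := by
  simpa using Measure.addHaar_ball_of_pos (volume : Measure (EuclideanSpace ℝ (Fin n))) x hr

theorem exists_volume_unitBall (n : ℕ) :
    ∃ ω : ℝ, 0 < ω ∧ volume (Metric.ball (0 : EuclideanSpace ℝ (Fin n)) 1) = ENNReal.ofReal ω := by
  have h0 : 0 < volume (Metric.ball (0 : EuclideanSpace ℝ (Fin n)) 1) :=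
    Metric.measure_ball_pos _ _ one_pos
  have h1 : volume (Metric.ball (0 : EuclideanSpace ℝ (Fin n)) 1) ≠ ∞ := measure_ball_lt_top.ne
  exact ⟨_, ENNReal.toReal_pos h0.ne' h1, (ENNReal.ofReal_toReal h1).symm⟩

theorem exists_lextension_const_le (n : ℕ) (hα : 0 < α) :
    ∃ C : ℝ, 0 < C ∧ ∀ (z : UpperHalfSpace n) (M : ℝ≥0∞),
      lextension α (fun _ => M) z ≤ ENNReal.ofReal C * M := by
  obtain ⟨C, hC, h⟩ := exists_lextension_le n hα
  obtain ⟨ω, hω, hv⟩ := exists_volume_unitBall n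
  refine ⟨C * ω, by positivity, fun z M => ?_⟩
  refine (h _ measurable_const z (M * ENNReal.ofReal ω) fun R hR => ?_).trans ?_
  · rw [setLIntegral_const, volume_closedBall_eq _ (le_trans (le_of_lt z.2.2) hR), hv]
    exact le_of_eq (by ring)
  · rw [ENNReal.ofReal_mul hC.le]
    exact le_of_eq (by ring)

/-- On B(x, t) one has |x - y|² + t² ≤ 2t², so the kernel is at least a constant times t^(-n), and
the ball has volume ω t^n. -/
theorem exists_le_lextension (n : ℕ) (hα : 0 < α) :
    ∃ c : ℝ, 0 < c ∧ ∀ (z : UpperHalfSpace n) (S : Set (EuclideanSpace ℝ (Fin n))),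
      Metric.ball z.1 (z.2 : ℝ) ⊆ S →
        ENNReal.ofReal c ≤ lextension α (S.indicator 1) z := by
  have hK := kernelConst_pos n hα
  obtain ⟨ω, hω, hv⟩ := exists_volume_unitBall n
  refine ⟨kernelConst n α / 2 ^ (((n : ℝ) + α) / 2) * ω, by positivity, fun z S hS => ?_⟩
  have ht : 0 < (z.2 : ℝ) := z.2.2
  set t : ℝ := (z.2 : ℝ) with htdef
  have hpow : (2 * t ^ 2) ^ (((n : ℝ) + α) / 2) = 2 ^ (((n : ℝ) + α) / 2) * (t ^ n * t ^ α) := by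
    rw [Real.mul_rpow (by norm_num) (by positivity), ← Real.rpow_natCast t 2,
      ← Real.rpow_mul ht.le, ← Real.rpow_natCast t n, ← Real.rpow_add ht]
    congr 2
    push_cast
    ring
  have hval : kernelConst n α / 2 ^ (((n : ℝ) + α) / 2) * ω =
      kernelConst n α * t ^ α / (2 * t ^ 2) ^ (((n : ℝ) + α) / 2) * (t ^ n * ω) := by
    have : 0 < t ^ α := by positivity
    rw [hpow]
    field_simp
  calc ENNReal.ofReal (kernelConst n α / 2 ^ (((n : ℝ) + α) / 2) * ω)
      = ∫⁻ _ in Metric.ball z.1 t,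
          ENNReal.ofReal (kernelConst n α * t ^ α / (2 * t ^ 2) ^ (((n : ℝ) + α) / 2)) := by
        rw [setLIntegral_const, volume_ball_eq _ ht, hv, hval, ENNReal.ofReal_mul (by positivity),
          ENNReal.ofReal_mul (by positivity)]
    _ ≤ ∫⁻ y in Metric.ball z.1 t,
          ENNReal.ofReal (poissonKernel α t (z.1 - y)) * S.indicator 1 y := by
        refine setLIntegral_mono' measurableSet_ball fun y hy => ?_
        rw [Set.indicator_of_mem (hS hy), Pi.one_apply, mul_one]
        refine ENNReal.ofReal_le_ofReal ?_
        unfold poissonKernel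
        rw [Metric.mem_ball, dist_comm, dist_eq_norm] at hy
        gcongr
        nlinarith [norm_nonneg (z.1 - y)]
    _ ≤ lextension α (S.indicator 1) z := setLIntegral_le_lintegral _ _

theorem exists_le_extension (n : ℕ) (hα : 0 < α) :
    ∃ c : ℝ, 0 < c ∧ ∀ (z : UpperHalfSpace n) (S : Set (EuclideanSpace ℝ (Fin n))),
      MeasurableSet S → Metric.ball z.1 (z.2 : ℝ) ⊆ S →
        ∀ a : ℝ, 0 ≤ a → a * c ≤ extension α (S.indicator fun _ => a) z := by
  obtain ⟨c, hc, h⟩ := exists_le_lextension n hα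
  obtain ⟨C, -, hC⟩ := exists_lextension_const_le n hα
  refine ⟨c, hc, fun z S hSm hS a ha => ?_⟩
  have hfin : lextension α (S.indicator 1) z ≠ ∞ := by
    refine ((lintegral_mono fun y => ?_).trans_lt
      ((hC z 1).trans_lt (by simp))).ne
    gcongr
    exact Set.indicator_le_self' (fun _ _ => zero_le) y
  have hm : Measurable fun y => poissonKernel α (z.2 : ℝ) (z.1 - y) :=
    (measurable_poissonKernel α).comp (measurable_const.prodMk measurable_id)
  have hpt : ∀ y, poissonKernel α (z.2 : ℝ) (z.1 - y) * S.indicator (fun _ => a) y =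
      a * (poissonKernel α (z.2 : ℝ) (z.1 - y) * S.indicator 1 y) := by
    intro y
    by_cases hy : y ∈ S <;> simp [hy, mul_comm]
  have heq : extension α (S.indicator fun _ => a) z =
      a * (lextension α (S.indicator 1) z).toReal := by
    unfold extension
    simp_rw [hpt]
    rw [integral_const_mul, integral_eq_lintegral_of_nonneg_ae]
    · congr 2
      refine lintegral_congr fun y => ?_
      by_cases hy : y ∈ S <;> simp [hy]
    · refine Filter.Eventually.of_forall fun y => ?_
      exact mul_nonneg (poissonKernel_nonneg hα z.2.2 _)
        (Set.indicator_nonneg (fun _ _ => zero_le_one) y)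
    · exact (hm.mul (measurable_one.indicator hSm)).aestronglyMeasurable
  rw [heq]
  exact mul_le_mul_of_nonneg_left ((ENNReal.ofReal_le_iff_le_toReal hfin).1 (h z S hS)) ha

/-! ### Weak and strong type bounds for shadows of level sets -/

/-- Weak (1, 1) bound: by the contrapositive of `exists_lextension_le`, each point of the level set
has a ball of radius R ≥ t on which g has large average. Disjoint Vitali balls pay for their
enlargements, and these cover the shadow because B(x, t) ⊆ B(x, R). -/
theorem exists_volume_shadow_le (hn : 1 ≤ n) (hα : 0 < α) :
    ∃ C : ℝ, 0 < C ∧ ∀ (g : EuclideanSpace ℝ (Fin n) → ℝ≥0∞), Measurable g → ∀ l : ℝ, 0 < l →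
      volume (shadow {z | ENNReal.ofReal l < lextension α g z}) ≤
        ENNReal.ofReal (C / l) * ∫⁻ y, g y := by
  obtain ⟨C₀, hC₀, hA⟩ := exists_lextension_le n hα
  obtain ⟨ω, hω, hv⟩ := exists_volume_unitBall n
  refine ⟨4 ^ n * ω * C₀, by positivity, fun g hg l hl => ?_⟩
  rcases eq_or_ne (∫⁻ y, g y) ∞ with htop | hfin
  · rw [htop, ENNReal.mul_top (by simpa using by positivity)]
    exact le_top
  set E : Set (UpperHalfSpace n) := {z | ENNReal.ofReal l < lextension α g z} with hE
  have hR : ∀ z : UpperHalfSpace n, ∃ R : ℝ, z ∈ E → (z.2 : ℝ) ≤ R ∧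
      ENNReal.ofReal (l / C₀ * R ^ n) ≤ ∫⁻ y in Metric.closedBall z.1 R, g y := by
    intro z
    by_contra! hcon
    have hz : z ∈ E := (hcon 0).1
    refine absurd (hA g hg z (ENNReal.ofReal (l / C₀)) fun R hR => ?_) (not_le.2 ?_)
    · rw [← ENNReal.ofReal_mul (by positivity)]
      exact ((hcon R).2 hR).le
    · rw [← ENNReal.ofReal_mul hC₀.le, mul_div_cancel₀ _ hC₀.ne']
      exact hz
  choose R hR using hR
  have hRpos : ∀ z ∈ E, 0 < R z := fun z hz => lt_of_lt_of_le z.2.2 (hR z hz).1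
  -- Vitali's lemma needs bounded radii: the integral of g is finite and controls R^n, and R ≤ R^n
  -- once R ≥ 1, since n ≥ 1.
  have hbound : ∀ z ∈ E, R z ≤ max 1 (C₀ / l * (∫⁻ y, g y).toReal) := by
    intro z hz
    rcases le_total (R z) 1 with h1 | h1
    · exact le_max_of_le_left h1
    refine le_max_of_le_right ?_
    have h2 := (hR z hz).2.trans (setLIntegral_le_lintegral _ _)
    rw [ENNReal.ofReal_le_iff_le_toReal hfin] at h2
    have h3 : R z ≤ R z ^ n := le_self_pow₀ h1 (by omega)
    calc R z ≤ R z ^ n := h3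
      _ = C₀ / l * (l / C₀ * R z ^ n) := by field_simp
      _ ≤ _ := by gcongr
  obtain ⟨u, huE, hdisj, hcov⟩ := Vitali.exists_disjoint_subfamily_covering_enlargement_closedBall
    E (fun z => z.1) R _ hbound 4 (by norm_num)
  have hcount : u.Countable := hdisj.countable_of_nonempty_interior fun z hz => by
    rw [interior_closedBall _ (hRpos z (huE hz)).ne']
    exact Metric.nonempty_ball.2 (hRpos z (huE hz))
  have hsub : shadow E ⊆ ⋃ z ∈ u, Metric.closedBall z.1 (4 * R z) := by
    refine Set.iUnion₂_subset fun z hz => ?_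
    obtain ⟨b, hb, hzb⟩ := hcov z hz
    exact ((Metric.ball_subset_closedBall.trans
      (Metric.closedBall_subset_closedBall (hR z hz).1)).trans hzb).trans
      (Set.subset_biUnion_of_mem (u := fun z => Metric.closedBall z.1 (4 * R z)) hb)
  have := hcount.to_subtype
  calc volume (shadow E) ≤ volume (⋃ z ∈ u, Metric.closedBall z.1 (4 * R z)) := measure_mono hsub
    _ ≤ ∑' z : u, volume (Metric.closedBall z.1.1 (4 * R z)) := measure_biUnion_le _ hcount _
    _ ≤ ∑' z : u, ENNReal.ofReal (4 ^ n * ω * C₀ / l) *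
          ∫⁻ y in Metric.closedBall z.1.1 (R z), g y := by
        refine ENNReal.tsum_le_tsum fun z => ?_
        have hz := hRpos z (huE z.2)
        rw [volume_closedBall_eq _ (by positivity), hv, ← ENNReal.ofReal_mul (by positivity)]
        calc ENNReal.ofReal ((4 * R z) ^ n * ω)
            = ENNReal.ofReal (4 ^ n * ω * C₀ / l) * ENNReal.ofReal (l / C₀ * R z ^ n) := by
              rw [← ENNReal.ofReal_mul (by positivity)]
              rw [mul_pow]
              congr 1
              field_simp
          _ ≤ _ := by gcongr; exact (hR z (huE z.2)).2
    _ = ENNReal.ofReal (4 ^ n * ω * C₀ / l) *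
          ∫⁻ y in ⋃ z ∈ u, Metric.closedBall z.1 (R z), g y := by
        rw [ENNReal.tsum_mul_left, lintegral_biUnion hcount
          (fun _ _ => Metric.isClosed_closedBall.measurableSet) hdisj]
    _ ≤ _ := by gcongr; exact Measure.restrict_le_self

/-- Marcinkiewicz truncation: with c = 1/(2D), the part of g below c l has extension at most l/2, so
the part above c l must exceed l/2, and the weak (1, 1) bound applies to it. -/
theorem exists_volume_shadow_le_setLIntegral (hn : 1 ≤ n) (hα : 0 < α) :
    ∃ C c : ℝ, 0 < C ∧ 0 < c ∧
      ∀ (g : EuclideanSpace ℝ (Fin n) → ℝ≥0∞), Measurable g → ∀ l : ℝ, 0 < l →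
        volume (shadow {z | ENNReal.ofReal l < lextension α g z}) ≤
          ENNReal.ofReal (C / l) * ∫⁻ y in {y | ENNReal.ofReal (c * l) < g y}, g y := by
  obtain ⟨C, hC, hweak⟩ := exists_volume_shadow_le hn hα
  obtain ⟨D, hD, hconst⟩ := exists_lextension_const_le n hα
  refine ⟨2 * C, 1 / (2 * D), by positivity, by positivity, fun g hg l hl => ?_⟩
  have hSm : MeasurableSet {y | ENNReal.ofReal (1 / (2 * D) * l) < g y} :=
    measurableSet_lt measurable_const hg
  have hm := hg.indicator hSm
  rw [← lintegral_indicator hSm]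
  rw [show 2 * C / l = C / (l / 2) by field_simp]
  refine (measure_mono (shadow_mono fun z hz => ?_)).trans (hweak _ hm (l / 2) (by positivity))
  have hle : lextension α g z ≤
      lextension α ({y | ENNReal.ofReal (1 / (2 * D) * l) < g y}.indicator g) z +
        ENNReal.ofReal (l / 2) := by
    calc lextension α g z ≤
        lextension α ({y | ENNReal.ofReal (1 / (2 * D) * l) < g y}.indicator g) z +
          lextension α (fun _ => ENNReal.ofReal (1 / (2 * D) * l)) z := by
          unfold lextension
          have hk : Measurable fun y => ENNReal.ofReal (poissonKernel α (z.2 : ℝ) (z.1 - y)) :=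
            ((measurable_poissonKernel α).comp
              (measurable_const.prodMk measurable_id)).ennreal_ofReal
          refine le_trans (lintegral_mono fun y => ?_) (lintegral_add_left (hk.mul hm) _).le
          rw [Pi.mul_apply, ← mul_add]
          gcongr
          by_cases hy : ENNReal.ofReal (1 / (2 * D) * l) < g y
          · rw [Set.indicator_of_mem (by exact hy)]
            exact le_self_add
          · exact (not_lt.1 hy).trans le_add_self
      _ ≤ _ := by
          gcongr
          refine (hconst z _).trans ?_
          rw [← ENNReal.ofReal_mul hD.le]
          refine ENNReal.ofReal_le_ofReal (le_of_eq ?_)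
          field_simp
  have hz' : ENNReal.ofReal (l / 2) + ENNReal.ofReal (l / 2) <
      lextension α ({y | ENNReal.ofReal (1 / (2 * D) * l) < g y}.indicator g) z +
        ENNReal.ofReal (l / 2) := by
    rw [← ENNReal.ofReal_add (by positivity) (by positivity), add_halves]
    exact lt_of_lt_of_le hz hle
  exact lt_of_add_lt_add_right hz'

theorem setLIntegral_le_mul_lintegral_rpow {X : Type*} [MeasurableSpace X] {ν : Measure X}
    {g : X → ℝ≥0∞} (hg : Measurable g) {p s : ℝ} (hp : 1 < p) (hs : 0 < s) :
    ∫⁻ y in {y | ENNReal.ofReal s < g y}, g y ∂ν ≤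
      ENNReal.ofReal (s ^ (1 - p)) * ∫⁻ y, g y ^ p ∂ν := by
  calc ∫⁻ y in {y | ENNReal.ofReal s < g y}, g y ∂ν
      ≤ ∫⁻ y in {y | ENNReal.ofReal s < g y}, ENNReal.ofReal (s ^ (1 - p)) * g y ^ p ∂ν := by
        refine setLIntegral_mono' (measurableSet_lt measurable_const hg) fun y hy => ?_
        have hs0 : ENNReal.ofReal s ≠ 0 := by simpa using hs
        rw [← ENNReal.ofReal_rpow_of_pos hs]
        calc g y = (ENNReal.ofReal s) ^ (1 - p) * (ENNReal.ofReal s) ^ (p - 1) * g y := by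
              rw [← ENNReal.rpow_add _ _ hs0 ENNReal.ofReal_ne_top]
              simp
          _ ≤ (ENNReal.ofReal s) ^ (1 - p) * g y ^ (p - 1) * g y := by
              gcongr
              exact le_of_lt hy
          _ = _ := by
              rw [mul_assoc]
              congr 1
              nth_rewrite 2 [← ENNReal.rpow_one (g y)]
              rw [← ENNReal.rpow_add_of_nonneg _ _ (by linarith) zero_le_one, sub_add_cancel]
    _ ≤ ∫⁻ y, ENNReal.ofReal (s ^ (1 - p)) * g y ^ p ∂ν := setLIntegral_le_lintegral _ _
    _ = _ := lintegral_const_mul _ (hg.pow_const p)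

theorem exists_volume_shadow_le_rpow (hn : 1 ≤ n) (hα : 0 < α) {p : ℝ} (hp : 1 < p) :
    ∃ C : ℝ, 0 < C ∧ ∀ (g : EuclideanSpace ℝ (Fin n) → ℝ≥0∞), Measurable g → ∀ l : ℝ, 0 < l →
      volume (shadow {z | ENNReal.ofReal l < lextension α g z}) ≤
        ENNReal.ofReal (C * l ^ (-p)) * ∫⁻ y, g y ^ p := by
  obtain ⟨C, c, hC, hc, h⟩ := exists_volume_shadow_le_setLIntegral hn hα
  refine ⟨C * c ^ (1 - p), by positivity, fun g hg l hl => ?_⟩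
  refine (h g hg l hl).trans ?_
  calc _ ≤ ENNReal.ofReal (C / l) *
        (ENNReal.ofReal ((c * l) ^ (1 - p)) * ∫⁻ y, g y ^ p) := by
          gcongr
          exact setLIntegral_le_mul_lintegral_rpow hg hp (by positivity)
    _ = _ := by
        rw [← mul_assoc, ← ENNReal.ofReal_mul (by positivity)]
        congr 2
        rw [Real.mul_rpow hc.le hl.le, show -p = (1 - p) - 1 by ring, Real.rpow_sub hl (1 - p) 1,
          Real.rpow_one]
        ring

/-- Integrate the truncated weak bound in l and exchange integrals. -/
theorem exists_lintegral_volume_shadow_le (hn : 1 ≤ n) (hα : 0 < α) {p : ℝ} (hp : 1 < p) :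
    ∃ C : ℝ, 0 < C ∧ ∀ f : EuclideanSpace ℝ (Fin n) → ℝ, Measurable f →
      ∫⁻ l in Set.Ioi (0 : ℝ),
        volume (shadow {z | ENNReal.ofReal l < lextension α (fun y => ‖f y‖ₑ) z}) *
          ENNReal.ofReal (l ^ (p - 1)) ≤ ENNReal.ofReal C * ∫⁻ y, ‖f y‖ₑ ^ p := by
  obtain ⟨C, c, hC, hc, h⟩ := exists_volume_shadow_le_setLIntegral hn hα
  have hp1 : 0 < p - 1 := by linarith
  refine ⟨C * ((p - 1)⁻¹ * c⁻¹ ^ (p - 1)), by positivity, fun f hf => ?_⟩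
  -- Layer cake with exponent p - 1 against |f| dy restores the full power |f|^p.
  set ν : Measure (EuclideanSpace ℝ (Fin n)) := volume.withDensity fun y => ‖f y‖ₑ with hν
  have hlayer := lintegral_rpow_eq_lintegral_meas_lt_mul ν (f := fun y => c⁻¹ * |f y|)
    (Filter.Eventually.of_forall fun y => by positivity) (by fun_prop) hp1
  have hset : ∀ l : ℝ, 0 < l → ∫⁻ y in {y | ENNReal.ofReal (c * l) < ‖f y‖ₑ}, ‖f y‖ₑ =
      ν {a | l < c⁻¹ * |f a|} := by
    intro l hl
    have hs : {y | ENNReal.ofReal (c * l) < ‖f y‖ₑ} = {a | l < c⁻¹ * |f a|} := by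
      ext y
      simp only [Set.mem_ofPred_eq]
      rw [Real.enorm_eq_ofReal_abs, ENNReal.ofReal_lt_ofReal_iff_of_nonneg (by positivity),
        inv_mul_eq_div, lt_div_iff₀ hc, mul_comm]
    rw [hs, hν, withDensity_apply _ (measurableSet_lt measurable_const (by fun_prop))]
  calc _ ≤ ∫⁻ l in Set.Ioi (0 : ℝ), ENNReal.ofReal C *
        (ν {a | l < c⁻¹ * |f a|} * ENNReal.ofReal (l ^ (p - 1 - 1))) := by
        refine setLIntegral_mono' measurableSet_Ioi fun l hl => ?_
        have hl : 0 < l := hl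
        refine (mul_le_mul_left (h _ hf.enorm l hl) _).trans (le_of_eq ?_)
        rw [hset l hl, mul_right_comm, ← ENNReal.ofReal_mul (by positivity),
          Real.rpow_sub_one hl.ne' (p - 1), div_mul_eq_mul_div, ← mul_div_assoc',
          ENNReal.ofReal_mul hC.le]
        ring
    _ = ENNReal.ofReal C * (ENNReal.ofReal (p - 1)⁻¹ *
          ∫⁻ y, ENNReal.ofReal ((c⁻¹ * |f y|) ^ (p - 1)) ∂ν) := by
        rw [lintegral_const_mul' _ _ ENNReal.ofReal_ne_top, hlayer, ← mul_assoc (ENNReal.ofReal (p - 1)⁻¹),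
          ← ENNReal.ofReal_mul (by positivity), inv_mul_cancel₀ hp1.ne', ENNReal.ofReal_one,
          one_mul]
    _ = ENNReal.ofReal C * (ENNReal.ofReal (p - 1)⁻¹ *
          ∫⁻ y, ENNReal.ofReal (c⁻¹ ^ (p - 1)) * ‖f y‖ₑ ^ p) := by
        rw [hν, lintegral_withDensity_eq_lintegral_mul _ (by fun_prop) (by fun_prop)]
        congr 2
        refine lintegral_congr fun y => ?_
        rw [Pi.mul_apply, Real.mul_rpow (by positivity) (abs_nonneg _),
          ENNReal.ofReal_mul (by positivity), ← ENNReal.ofReal_rpow_of_nonneg (abs_nonneg _) hp1.le,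
          ← Real.enorm_eq_ofReal_abs, mul_left_comm]
        congr 1
        nth_rewrite 1 [← ENNReal.rpow_one ‖f y‖ₑ]
        rw [← ENNReal.rpow_add_of_nonneg _ _ zero_le_one hp1.le, add_sub_cancel]
    _ = _ := by
        rw [lintegral_const_mul _ (by fun_prop), ENNReal.ofReal_mul hC.le,
          ENNReal.ofReal_mul (by positivity)]
        ring

/-! ### Chebyshev's inequality and the capacity of compact sets -/

theorem eLpNorm_ofReal_rpow {X : Type*} [MeasurableSpace X] (ν : Measure X) (f : X → ℝ) {q : ℝ}
    (hq : 0 < q) : eLpNorm f (ENNReal.ofReal q) ν ^ q = ∫⁻ x, ‖f x‖ₑ ^ q ∂ν := by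
  rw [eLpNorm_eq_lintegral_rpow_enorm_toReal (by simpa using hq) ENNReal.ofReal_ne_top,
    ENNReal.toReal_ofReal hq.le, ← ENNReal.rpow_mul, one_div, inv_mul_cancel₀ hq.ne',
    ENNReal.rpow_one]

theorem rpow_mul_measure_le_eLpNorm_rpow {X : Type*} [MeasurableSpace X] {ν : Measure X}
    {f : X → ℝ} {q : ℝ} (hq : 0 < q) {S : Set X} (hS : MeasurableSet S) {a : ℝ≥0∞}
    (h : ∀ x ∈ S, a ≤ ‖f x‖ₑ) : a ^ q * ν S ≤ eLpNorm f (ENNReal.ofReal q) ν ^ q := by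
  rw [eLpNorm_ofReal_rpow ν f hq, ← setLIntegral_const]
  refine (setLIntegral_mono' hS fun x hx => ?_).trans (setLIntegral_le_lintegral S _)
  exact ENNReal.rpow_le_rpow (h x hx) hq.le

/-- The competitor is c⁻¹ times the indicator of the shadow. Its existence also shows that the
default value 0 of `capacity` never intervenes for compact sets. -/
theorem exists_capacity_le (n : ℕ) (hα : 0 < α) {p : ℝ} (hp : 0 < p) :
    ∃ C : ℝ, 0 < C ∧ ∀ K : Set (UpperHalfSpace n), IsCompact K →
      (admissible α p K).Nonempty ∧
        capacity α p K ≤ ENNReal.ofReal C * volume (shadow K) := by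
  obtain ⟨c, hc, h⟩ := exists_le_extension n hα
  refine ⟨c⁻¹ ^ p, by positivity, fun K hK => ?_⟩
  have hm := (isOpen_shadow K).measurableSet
  have hmem : (shadow K).indicator (fun _ => c⁻¹) ∈ admissible α p K := by
    refine ⟨memLp_indicator_const _ hm _ (Or.inr (volume_shadow_ne_top hK)),
      fun y => Set.indicator_nonneg (fun _ _ => by positivity) y, fun z hz => ?_⟩
    have := h z (shadow K) hm (ball_subset_shadow hz) c⁻¹ (by positivity)
    rwa [inv_mul_cancel₀ hc.ne'] at this
  refine ⟨⟨_, hmem⟩, ?_⟩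
  unfold capacity
  rw [if_pos ⟨_, hmem⟩]
  refine (iInf₂_le _ hmem).trans (le_of_eq ?_)
  rw [eLpNorm_indicator_const hm (by simpa using hp) ENNReal.ofReal_ne_top,
    ENNReal.toReal_ofReal hp.le, ENNReal.mul_rpow_of_nonneg _ _ hp.le, ← ENNReal.rpow_mul, one_div,
    inv_mul_cancel₀ hp.ne', ENNReal.rpow_one, Real.enorm_of_nonneg (by positivity),
    ENNReal.ofReal_rpow_of_nonneg (by positivity) hp.le]

/-! ### The shadow bound, the capacity condition and the embedding -/

/-- The measure of every compact set is at most `A` times the power `β` of the volume of its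
shadow. -/
def ShadowBound (β : ℝ) (A : ℝ≥0∞) (μ : Measure (UpperHalfSpace n)) : Prop :=
  ∀ K : Set (UpperHalfSpace n), IsCompact K → μ K ≤ A * volume (shadow K) ^ β

theorem Embedding.capacityRatioSup_lt_top (hα : 0 < α) {p q : ℝ} (hp : 0 < p) (hq : 0 < q)
    {μ : Measure (UpperHalfSpace n)} (h : Embedding α p q μ) : capacityRatioSup α p q μ < ∞ := by
  obtain ⟨C, hC⟩ := h
  obtain ⟨_, _, hcap⟩ := exists_capacity_le n hα hp
  -- C + 1 replaces C so that dividing by the constant is legitimate even when C = 0.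
  have hB0 : ((C : ℝ≥0∞) + 1) ^ p ≠ 0 :=
    (ENNReal.rpow_pos (by simp) (by finiteness)).ne'
  have hBtop : ((C : ℝ≥0∞) + 1) ^ p ≠ ∞ := by finiteness
  refine lt_of_le_of_lt (iSup₂_le fun l hl => ?_) hBtop.lt_top
  refine ENNReal.div_le_of_le_mul ?_
  rw [mul_comm, ← ENNReal.div_le_iff hB0 hBtop]
  unfold capacityMin
  refine le_iInf₂ fun K hK => le_iInf fun hlK => ?_
  unfold capacity
  rw [if_pos (hcap K hK).1]
  refine le_iInf₂ fun f hf => ?_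
  rw [ENNReal.div_le_iff hB0 hBtop]
  have h1 : ENNReal.ofReal l ≤ (C * eLpNorm f (ENNReal.ofReal p) volume) ^ q := by
    refine hlK.trans (le_trans ?_ (ENNReal.rpow_le_rpow (hC f hf.1) hq.le))
    have := rpow_mul_measure_le_eLpNorm_rpow (ν := μ) (f := extension α f) (a := 1) hq
      hK.measurableSet fun z hz => ?_
    · simpa using this
    · have h2 := hf.2.2 z hz
      rw [Real.enorm_of_nonneg (by linarith)]
      simpa using h2
  rw [← ENNReal.ofReal_rpow_of_pos hl]
  calc ENNReal.ofReal l ^ (p / q)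
      ≤ ((C * eLpNorm f (ENNReal.ofReal p) volume) ^ q) ^ (p / q) :=
        ENNReal.rpow_le_rpow h1 (by positivity)
    _ = eLpNorm f (ENNReal.ofReal p) volume ^ p * (C : ℝ≥0∞) ^ p := by
        rw [← ENNReal.rpow_mul, mul_div_cancel₀ _ hq.ne', ENNReal.mul_rpow_of_nonneg _ _ hp.le,
          mul_comm]
    _ ≤ _ := by
        gcongr
        exact le_self_add

/-- K itself competes in `capacityMin` at the level λ = μ(K), finite by compactness and positive
outside a trivial case. -/
theorem exists_shadowBound_of_capacityRatioSup_lt_top (hα : 0 < α) {p q : ℝ} (hp : 0 < p)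
    (hq : 0 < q) {μ : Measure (UpperHalfSpace n)} [IsFiniteMeasureOnCompacts μ]
    (h : capacityRatioSup α p q μ < ∞) : ∃ A : ℝ≥0∞, A ≠ ∞ ∧ ShadowBound (q / p) A μ := by
  obtain ⟨C, hC, hcap⟩ := exists_capacity_le n hα hp
  refine ⟨(capacityRatioSup α p q μ * ENNReal.ofReal C) ^ (q / p),
    ENNReal.rpow_ne_top_of_nonneg (by positivity) (ENNReal.mul_ne_top h.ne ENNReal.ofReal_ne_top),
    fun K hK => ?_⟩
  rcases eq_or_ne (μ K) 0 with h0 | h0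
  · simp [h0]
  have htop : μ K ≠ ∞ := hK.measure_lt_top.ne
  have hl : 0 < (μ K).toReal := ENNReal.toReal_pos h0 htop
  have hmin : capacityMin α p μ (μ K).toReal ≤ ENNReal.ofReal C * volume (shadow K) :=
    (iInf₂_le_of_le K hK (iInf_le_of_le (ENNReal.ofReal_toReal htop).le le_rfl)).trans
      (hcap K hK).2
  have hmtop : capacityMin α p μ (μ K).toReal ≠ ∞ :=
    ne_top_of_le_ne_top (ENNReal.mul_ne_top ENNReal.ofReal_ne_top (volume_shadow_ne_top hK)) hmin
  have hle : ENNReal.ofReal ((μ K).toReal ^ (p / q)) / capacityMin α p μ (μ K).toReal ≤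
      capacityRatioSup α p q μ :=
    le_iSup₂ (f := fun (l : ℝ) (_ : 0 < l) =>
      ENNReal.ofReal (l ^ (p / q)) / capacityMin α p μ l) (μ K).toReal hl
  rw [ENNReal.div_le_iff_le_mul (Or.inr h.ne) (Or.inl hmtop), ← ENNReal.ofReal_rpow_of_pos hl,
    ENNReal.ofReal_toReal htop] at hle
  calc μ K = (μ K ^ (p / q)) ^ (q / p) := by
        rw [← ENNReal.rpow_mul, div_mul_div_cancel₀ hq.ne', div_self hp.ne', ENNReal.rpow_one]
    _ ≤ (capacityRatioSup α p q μ * (ENNReal.ofReal C * volume (shadow K))) ^ (q / p) := by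
        refine ENNReal.rpow_le_rpow (hle.trans ?_) (by positivity)
        gcongr
    _ = _ := by
        rw [← mul_assoc, ENNReal.mul_rpow_of_nonneg _ _ (by positivity)]

theorem sigmaFinite_of_regular (μ : Measure (UpperHalfSpace n)) [μ.Regular] : SigmaFinite μ := by
  have : LocallyCompactSpace (Set.Ioi (0 : ℝ)) := isOpen_Ioi.locallyCompactSpace
  have : IsLocallyFiniteMeasure μ := isLocallyFiniteMeasure_of_isFiniteMeasureOnCompacts
  infer_instance

/-- Inner regularity: the level sets of the extension are measurable but need not be compact.
σ-finiteness covers sets of infinite measure. -/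
theorem ShadowBound.measure_le {β : ℝ} {A : ℝ≥0∞} {μ : Measure (UpperHalfSpace n)} [μ.Regular]
    (hβ : 0 ≤ β) (h : ShadowBound β A μ) {E : Set (UpperHalfSpace n)} (hE : MeasurableSet E) :
    μ E ≤ A * volume (shadow E) ^ β := by
  have := sigmaFinite_of_regular μ
  rw [hE.measure_eq_iSup_isCompact]
  refine iSup₂_le fun K hKE => iSup_le fun hK => (h K hK).trans ?_
  gcongr
  exact shadow_mono hKE

theorem ShadowBound.embedding (hn : 1 ≤ n) (hα : 0 < α) {p q : ℝ} (hp : 1 < p) (hpq : p ≤ q)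
    {μ : Measure (UpperHalfSpace n)} [μ.Regular] {A : ℝ≥0∞} (hA : A ≠ ∞)
    (h : ShadowBound (q / p) A μ) : Embedding α p q μ := by
  have hp0 : 0 < p := by linarith
  have hq0 : 0 < q := by linarith
  have hβ : 0 ≤ q / p - 1 := by rw [sub_nonneg, one_le_div hp0]; exact hpq
  obtain ⟨C₁, hC₁, hweak⟩ := exists_volume_shadow_le_rpow hn hα hp
  obtain ⟨C₂, hC₂, hstrong⟩ := exists_lintegral_volume_shadow_le hn hα hp
  set D : ℝ≥0∞ := ENNReal.ofReal q *
    (A * ENNReal.ofReal (C₁ ^ (q / p - 1)) * ENNReal.ofReal C₂) with hD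
  have hDtop : D ≠ ∞ := by finiteness
  have hDtop' : D ^ (1 / q) ≠ ∞ := ENNReal.rpow_ne_top_of_nonneg (by positivity) hDtop
  have main : ∀ f : EuclideanSpace ℝ (Fin n) → ℝ, StronglyMeasurable f →
      MemLp f (ENNReal.ofReal p) volume →
      ∫⁻ z, ‖extension α f z‖ₑ ^ q ∂μ ≤ D * (∫⁻ y, ‖f y‖ₑ ^ p) ^ (q / p) := by
    intro f hf hmem
    set N : ℝ≥0∞ := ∫⁻ y, ‖f y‖ₑ ^ p with hN
    have hNtop : N ≠ ∞ := by
      rw [hN, ← eLpNorm_ofReal_rpow volume f hp0]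
      exact ENNReal.rpow_ne_top_of_nonneg hp0.le hmem.2.ne
    have hext := (stronglyMeasurable_extension (α := α) hf).measurable
    have hlevel : ∀ l : ℝ, 0 < l →
        μ {z | l < |extension α f z|} * ENNReal.ofReal (l ^ (q - 1)) ≤
          (A * ENNReal.ofReal (C₁ ^ (q / p - 1)) * N ^ (q / p - 1)) *
          (volume (shadow {z | ENNReal.ofReal l < lextension α (fun y => ‖f y‖ₑ) z}) *
            ENNReal.ofReal (l ^ (p - 1))) := by
      intro l hl
      set S := volume (shadow {z | ENNReal.ofReal l < lextension α (fun y => ‖f y‖ₑ) z})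
      have h1 : μ {z | l < |extension α f z|} ≤ A * S ^ (q / p) := by
        refine (measure_mono fun z hz => ?_).trans (h.measure_le (by positivity)
          (measurableSet_lt measurable_const (measurable_lextension hf.measurable.enorm)))
        refine lt_of_lt_of_le ?_ (enorm_extension_le hα f z)
        rw [Real.enorm_eq_ofReal_abs]
        exact (ENNReal.ofReal_lt_ofReal_iff_of_nonneg hl.le).2 hz
      -- One factor S is kept for the strong bound; the weak bound turns S^(q/p - 1) into l^(p - q)
      -- N^(q/p - 1), and l^(p - q) l^(q - 1) = l^(p - 1) is exactly the weight there.
      have h2 : S ^ (q / p) ≤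
          S * (ENNReal.ofReal (C₁ ^ (q / p - 1)) * ENNReal.ofReal (l ^ (p - q)) *
            N ^ (q / p - 1)) := by
        calc S ^ (q / p) = S * S ^ (q / p - 1) := by
              nth_rewrite 2 [← ENNReal.rpow_one S]
              rw [← ENNReal.rpow_add_of_nonneg _ _ zero_le_one hβ, add_sub_cancel]
          _ ≤ S * (ENNReal.ofReal (C₁ * l ^ (-p)) * N) ^ (q / p - 1) := by
              gcongr
              exact hweak _ hf.measurable.enorm l hl
          _ = _ := by
              rw [ENNReal.mul_rpow_of_nonneg _ _ hβ,
                ENNReal.ofReal_rpow_of_nonneg (by positivity) hβ,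
                Real.mul_rpow hC₁.le (by positivity), ← Real.rpow_mul hl.le,
                ENNReal.ofReal_mul (by positivity)]
              congr 5
              field_simp
              ring
      have h3 : ENNReal.ofReal (l ^ (p - q)) * ENNReal.ofReal (l ^ (q - 1)) =
          ENNReal.ofReal (l ^ (p - 1)) := by
        rw [← ENNReal.ofReal_mul (by positivity), ← Real.rpow_add hl]
        congr 2
        ring
      rw [← h3]
      calc _ ≤ A * (S * (ENNReal.ofReal (C₁ ^ (q / p - 1)) * ENNReal.ofReal (l ^ (p - q)) *
            N ^ (q / p - 1))) * ENNReal.ofReal (l ^ (q - 1)) := by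
            gcongr
            exact h1.trans (by gcongr)
        _ = _ := by ring
    have hlayer := lintegral_rpow_eq_lintegral_meas_lt_mul μ (f := fun z => |extension α f z|)
      (Filter.Eventually.of_forall fun z => abs_nonneg _) (by fun_prop) hq0
    calc ∫⁻ z, ‖extension α f z‖ₑ ^ q ∂μ
        = ∫⁻ z, ENNReal.ofReal (|extension α f z| ^ q) ∂μ := by
          refine lintegral_congr fun z => ?_
          rw [Real.enorm_eq_ofReal_abs, ENNReal.ofReal_rpow_of_nonneg (abs_nonneg _) hq0.le]
      _ ≤ ENNReal.ofReal q * ((A * ENNReal.ofReal (C₁ ^ (q / p - 1)) * N ^ (q / p - 1)) *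
            (ENNReal.ofReal C₂ * N)) := by
          rw [hlayer]
          gcongr
          refine (setLIntegral_mono' measurableSet_Ioi fun l hl => hlevel l hl).trans ?_
          rw [lintegral_const_mul' _ _ (by finiteness)]
          gcongr
          exact hstrong f hf.measurable
      _ = D * (N ^ (q / p - 1) * N) := by rw [hD]; ring
      _ = _ := by
          nth_rewrite 2 [← ENNReal.rpow_one N]
          rw [← ENNReal.rpow_add_of_nonneg _ _ hβ zero_le_one, sub_add_cancel]
  -- A strongly measurable representative of f may be used: it has the same extension at every
  -- point.
  refine ⟨(D ^ (1 / q)).toNNReal, fun f hf => ?_⟩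
  obtain ⟨g, hg, hae⟩ := hf.1
  rw [extension_congr_ae hae, eLpNorm_congr_ae hae, ENNReal.coe_toNNReal hDtop',
    ← ENNReal.rpow_le_rpow_iff hq0, eLpNorm_ofReal_rpow _ _ hq0]
  refine (main g hg ((memLp_congr_ae hae).1 hf)).trans (le_of_eq ?_)
  rw [ENNReal.mul_rpow_of_nonneg _ _ hq0.le, ← ENNReal.rpow_mul, one_div_mul_cancel hq0.ne',
    ENNReal.rpow_one, ← eLpNorm_ofReal_rpow _ _ hp0, ← ENNReal.rpow_mul,
    mul_div_cancel₀ _ hp0.ne']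

/-! ### The ball condition -/

theorem isOpen_halfSpaceBall (r : ℝ) (x₀ : EuclideanSpace ℝ (Fin n)) (t₀ : ℝ) :
    IsOpen (halfSpaceBall r x₀ t₀) := by
  unfold halfSpaceBall
  refine IsOpen.and (isOpen_lt ?_ ?_) (IsOpen.and (isOpen_lt ?_ ?_) (isOpen_lt ?_ ?_)) <;> fun_prop

theorem Embedding.ballRatioSup_lt_top (hα : 0 < α) {p q : ℝ} (hp : 0 < p) (hq : 0 < q)
    {κ : ℝ} (hκ : 0 < κ) {μ : Measure (UpperHalfSpace n)} (h : Embedding α p q μ) :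
    ballRatioSup p q κ μ < ∞ := by
  obtain ⟨C, hC⟩ := h
  obtain ⟨c, hc, hlow⟩ := exists_le_extension n hα
  obtain ⟨ω, hω, hv⟩ := exists_volume_unitBall n
  set B : ℝ := (C : ℝ) ^ q * ((3 + κ) ^ n * ω) ^ (q / p) / c ^ q with hB
  refine lt_of_le_of_lt ?_ (ENNReal.ofReal_lt_top (r := B))
  refine iSup_le fun r => iSup_le fun x₀ => iSup_le fun t₀ => iSup_le fun hr => iSup_le fun _ =>
    iSup_le fun ht => ?_
  refine ENNReal.div_le_of_le_mul ?_
  -- Points of `halfSpaceBall r x₀ t₀` have height below t₀ + 2r ≤ (κ + 2)r and lie within r/2 of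
  -- x₀, so their balls B(x, t) fit inside radius (3 + κ)r.
  set T := Metric.ball x₀ ((3 + κ) * r) with hT
  have hTm : MeasurableSet T := measurableSet_ball
  have hTv : volume T = ENNReal.ofReal (((3 + κ) * r) ^ n * ω) := by
    rw [hT, volume_ball_eq _ (by positivity), hv, ← ENNReal.ofReal_mul (by positivity)]
  have hmem : MemLp (T.indicator fun _ => (1 : ℝ)) (ENNReal.ofReal p) volume :=
    memLp_indicator_const _ hTm _ (Or.inr measure_ball_lt_top.ne)
  have hle : ∀ z ∈ halfSpaceBall r x₀ t₀,
      ENNReal.ofReal c ≤ ‖extension α (T.indicator fun _ => (1 : ℝ)) z‖ₑ := by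
    intro z hz
    obtain ⟨hz1, -, hz3⟩ := hz
    have hsub : Metric.ball z.1 (z.2 : ℝ) ⊆ T := by
      refine Metric.ball_subset_ball' ?_
      rw [dist_eq_norm]
      linarith
    have := hlow z T hTm hsub 1 zero_le_one
    rw [one_mul] at this
    rw [Real.enorm_of_nonneg (hc.le.trans this)]
    exact ENNReal.ofReal_le_ofReal this
  have h1 := (rpow_mul_measure_le_eLpNorm_rpow (ν := μ) hq
    (isOpen_halfSpaceBall r x₀ t₀).measurableSet hle).trans
    (ENNReal.rpow_le_rpow (hC _ hmem) hq.le)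
  have hcq : 0 < c ^ q := by positivity
  rw [eLpNorm_indicator_const hTm (by simpa using hp) ENNReal.ofReal_ne_top,
    ENNReal.toReal_ofReal hp.le, hTv, enorm_one, one_mul, ENNReal.ofReal_rpow_of_pos hc,
    ENNReal.ofReal_rpow_of_pos (by positivity), ← ENNReal.ofReal_coe_nnreal,
    ← ENNReal.ofReal_mul C.coe_nonneg, ENNReal.ofReal_rpow_of_nonneg (by positivity) hq.le, mul_comm,
    ← ENNReal.le_div_iff_mul_le (Or.inl (by simpa using hcq)) (Or.inl ENNReal.ofReal_ne_top),
    ← ENNReal.ofReal_div_of_pos hcq] at h1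
  refine h1.trans (le_of_eq ?_)
  rw [← ENNReal.ofReal_mul (by positivity)]
  congr 1
  have e1 : (((3 + κ) * r) ^ n * ω) = ((3 + κ) ^ n * ω) * r ^ n := by
    rw [mul_pow]
    ring
  have e2 : ((r ^ n : ℝ)) ^ (q / p) = r ^ (q * (n : ℝ) / p) := by
    rw [← Real.rpow_natCast, ← Real.rpow_mul hr.le]
    congr 1
    ring
  rw [Real.mul_rpow C.coe_nonneg (by positivity), ← Real.rpow_mul (by positivity), one_div_mul_eq_div, e1,
    Real.mul_rpow (by positivity) (by positivity), e2, hB]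
  ring

/-- Fubini on the pairs (z, x) with |z.1 - x| < r/2: each z ∈ E sees a full ball of radius r/2
inside U, while each x sees only points of one half-space ball. -/
theorem volume_ball_mul_measure_le {μ : Measure (UpperHalfSpace n)} [SFinite μ]
    {E : Set (UpperHalfSpace n)} (hE : MeasurableSet E) {U : Set (EuclideanSpace ℝ (Fin n))}
    (hU : MeasurableSet U) {r t₀ : ℝ} (hr : 0 < r)
    (hEU : ∀ z ∈ E, Metric.ball z.1 (r / 2) ⊆ U)
    (ht : ∀ z ∈ E, r < (z.2 : ℝ) - t₀ ∧ (z.2 : ℝ) - t₀ < 2 * r) {M : ℝ≥0∞}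
    (hM : ∀ x, μ (halfSpaceBall r x t₀) ≤ M) :
    ENNReal.ofReal ((r / 2) ^ n) * volume (Metric.ball (0 : EuclideanSpace ℝ (Fin n)) 1) * μ E ≤
      M * volume U := by
  set W : Set (UpperHalfSpace n × EuclideanSpace ℝ (Fin n)) := {w | ‖w.1.1 - w.2‖ < r / 2} with hW
  have hWm : MeasurableSet W := (isOpen_lt (by fun_prop) (by fun_prop)).measurableSet
  have hF : Measurable (W.indicator (1 : UpperHalfSpace n × EuclideanSpace ℝ (Fin n) → ℝ≥0∞)) := measurable_one.indicator hWm
  calc _ = ∫⁻ z in E, volume (Metric.ball z.1 (r / 2)) ∂μ := by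
        simp_rw [volume_ball_eq _ (half_pos hr)]
        rw [setLIntegral_const]
    _ ≤ ∫⁻ z in E, (∫⁻ x in U, W.indicator 1 (z, x)) ∂μ := by
        refine setLIntegral_mono' hE fun z hz => ?_
        rw [← lintegral_indicator_one measurableSet_ball, ← lintegral_indicator hU]
        refine lintegral_mono fun x => ?_
        by_cases hx : x ∈ Metric.ball z.1 (r / 2)
        · have hxW : (z, x) ∈ W := by
            rw [Metric.mem_ball, dist_comm, dist_eq_norm] at hx
            exact hx
          rw [Set.indicator_of_mem (hEU z hz hx), Set.indicator_of_mem hxW,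
            Set.indicator_of_mem hx]
          exact le_rfl
        · rw [Set.indicator_of_notMem hx]
          exact zero_le
    _ = ∫⁻ x in U, (∫⁻ z in E, W.indicator 1 (z, x) ∂μ) :=
        lintegral_lintegral_swap (f := fun z x => W.indicator 1 (z, x)) hF.aemeasurable
    _ ≤ ∫⁻ _ in U, M := by
        refine lintegral_mono fun x => le_trans ?_ (hM x)
        rw [← lintegral_indicator_one (isOpen_halfSpaceBall r x t₀).measurableSet,
          ← lintegral_indicator hE]
        refine lintegral_mono fun z => ?_
        by_cases hz : z ∈ E
        · rw [Set.indicator_of_mem hz]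
          by_cases hzW : (z, x) ∈ W
          · rw [Set.indicator_of_mem hzW,
              Set.indicator_of_mem (show z ∈ halfSpaceBall r x t₀ from ⟨hzW, ht z hz⟩)]
            exact le_rfl
          · rw [Set.indicator_of_notMem hzW]
            exact zero_le
        · rw [Set.indicator_of_notMem hz]
          exact zero_le
    _ = _ := setLIntegral_const _ _

/-- Layers of K at heights comparable to r have mass at most C |S(K)| r^γ; since q > p makes γ
positive, the tallest layer dominates the sum. -/
theorem exists_shadowBound_of_ballRatioSup_lt_top (hn : 1 ≤ n) {p q : ℝ} (hp : 0 < p)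
    (hpq : p < q) {κ : ℝ} (hκ : 0 < κ) {μ : Measure (UpperHalfSpace n)} [SFinite μ]
    (h : ballRatioSup p q κ μ < ∞) : ∃ A : ℝ≥0∞, A ≠ ∞ ∧ ShadowBound (q / p) A μ := by
  obtain ⟨ω, hω, hv⟩ := exists_volume_unitBall n
  obtain ⟨Q, hQ⟩ : ∃ Q : NNReal, ballRatioSup p q κ μ = Q :=
    ⟨_, (ENNReal.coe_toNNReal h.ne).symm⟩
  have hβ : 0 < q / p - 1 := by rw [sub_pos, one_lt_div hp]; exact hpq
  have hβ0 : 0 ≤ q / p := by linarith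
  have hn0 : (0 : ℝ) < n := by exact_mod_cast hn
  set γ : ℝ := n * (q / p - 1) with hγ
  have hγ0 : 0 < γ := by positivity
  -- A layer has height ratio 4/3, and it must fit in the window ((1 + δ)r, (2 + δ)r) given by t₀ =
  -- δr; as δ ≤ 1, (4/3)(1 + δ) < 2 + δ.
  set ρ : ℝ := 3 / 4 with hρ
  have hρ0 : 0 < ρ := by norm_num [hρ]
  have hργ : ρ ^ γ < 1 := Real.rpow_lt_one hρ0.le (by norm_num [hρ]) hγ0
  have hργ0 : 0 ≤ ρ ^ γ := by positivity
  -- The choice t₀ = δr is positive and at most κr, so it is allowed in the supremum.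
  set δ : ℝ := min κ 1 with hδ
  have hδ0 : 0 < δ := lt_min hκ one_pos
  have hδ1 : δ ≤ 1 := min_le_right _ _
  have hball : ∀ r : ℝ, 0 < r → ∀ x : EuclideanSpace ℝ (Fin n),
      μ (halfSpaceBall r x (δ * r)) ≤ ENNReal.ofReal (Q * r ^ (q * (n : ℝ) / p)) := by
    intro r hr x
    have h1 : μ (halfSpaceBall r x (δ * r)) / ENNReal.ofReal (r ^ (q * (n : ℝ) / p)) ≤ Q := by
      rw [← hQ]
      unfold ballRatioSup
      refine le_iSup_of_le r (le_iSup_of_le x (le_iSup_of_le (δ * r) (le_iSup_of_le hr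
        (le_iSup_of_le (by positivity) (le_iSup_of_le ?_ le_rfl)))))
      gcongr
      exact min_le_left _ _
    have h2 : 0 < r ^ (q * (n : ℝ) / p) := by positivity
    rwa [ENNReal.div_le_iff (by simpa using h2) ENNReal.ofReal_ne_top,
      ← ENNReal.ofReal_coe_nnreal, ← ENNReal.ofReal_mul Q.coe_nonneg] at h1
  refine ⟨ENNReal.ofReal (Q * 2 ^ n * ω⁻¹ ^ (q / p) * (1 - ρ ^ γ)⁻¹),
    ENNReal.ofReal_ne_top, fun K hK => ?_⟩
  rcases K.eq_empty_or_nonempty with rfl | ⟨z₀, hz₀⟩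
  · simp
  have hVtop := volume_shadow_ne_top hK
  set v : ℝ := (volume (shadow K)).toReal with hvdef
  have hVv : volume (shadow K) = ENNReal.ofReal v := (ENNReal.ofReal_toReal hVtop).symm
  have hpow : ∀ z ∈ K, (z.2 : ℝ) ^ n * ω ≤ v := by
    intro z hz
    have h1 := measure_mono (μ := volume) (ball_subset_shadow hz)
    have hz2 : 0 < (z.2 : ℝ) := z.2.2
    rwa [volume_ball_eq _ hz2, hv, ← ENNReal.ofReal_mul (by positivity),
      ENNReal.ofReal_le_iff_le_toReal hVtop] at h1
  have hv0 : 0 < v := by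
    have hz2 : 0 < (z₀.2 : ℝ) := z₀.2.2
    exact lt_of_lt_of_le (by positivity) (hpow z₀ hz₀)
  -- R is the radius of a ball of volume v = |S(K)|. Since B(x, t) ⊆ S(K) for (x, t) ∈ K, no height
  -- exceeds R.
  set R : ℝ := (v / ω) ^ ((n : ℝ)⁻¹) with hRdef
  have hR0 : 0 < R := by positivity
  have hRn : R ^ n = v / ω := Real.rpow_inv_natCast_pow (by positivity) (by omega)
  have hheight : ∀ z ∈ K, (z.2 : ℝ) ≤ R := by
    intro z hz
    refine le_of_pow_le_pow_left₀ (n := n) (by omega) hR0.le ?_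
    rw [hRn, le_div_iff₀ hω]
    exact hpow z hz
  set L : ℕ → Set (UpperHalfSpace n) := fun k =>
    K ∩ (fun z => (z.2 : ℝ)) ⁻¹' Set.Ioc (R * ρ ^ (k + 1)) (R * ρ ^ k) with hL
  have hcover : K ⊆ ⋃ k, L k := by
    intro z hz
    have hz2 : 0 < (z.2 : ℝ) := z.2.2
    obtain ⟨k, hk1, hk2⟩ := exists_nat_pow_near_of_lt_one (div_pos hz2 hR0)
      ((div_le_one hR0).2 (hheight z hz)) hρ0 (by norm_num [hρ])
    refine Set.mem_iUnion.2 ⟨k, hz, ?_, ?_⟩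
    · rwa [lt_div_iff₀' hR0] at hk1
    · rwa [div_le_iff₀' hR0] at hk2
  have hlevel : ∀ k, μ (L k) ≤
      ENNReal.ofReal (Q * 2 ^ n * (v / ω) ^ (q / p) * (ρ ^ γ) ^ k) := by
    intro k
    -- Chosen so that the bottom of the k-th layer is exactly t₀ + r.
    set r : ℝ := R * ρ ^ (k + 1) / (1 + δ) with hr
    have hr0 : 0 < r := by positivity
    have hr1 : (1 + δ) * r = R * ρ ^ (k + 1) := by rw [hr]; field_simp
    have hr2 : R * ρ ^ k = 4 / 3 * ((1 + δ) * r) := by rw [hr1, hρ]; ring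
    have hrle : r ≤ R * ρ ^ k := by nlinarith [mul_pos hδ0 hr0]
    have hLm : MeasurableSet (L k) :=
      hK.measurableSet.inter (measurableSet_Ioc.preimage (by fun_prop))
    have key := volume_ball_mul_measure_le (μ := μ) hLm (isOpen_shadow K).measurableSet
      (t₀ := δ * r) hr0
      (fun z hz => (Metric.ball_subset_ball (by
        have h1 := hz.2.1
        nlinarith [mul_pos hδ0 hr0])).trans (ball_subset_shadow hz.1))
      (fun z hz => by
        obtain ⟨-, h1, h2⟩ := hz
        rw [← hr1] at h1
        rw [hr2] at h2
        constructor <;> nlinarith [mul_le_mul_of_nonneg_right hδ1 hr0.le])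
      (hball r hr0)
    have hpos : 0 < (r / 2) ^ n * ω := by positivity
    rw [hv, hVv, ← ENNReal.ofReal_mul (by positivity), ← ENNReal.ofReal_mul (by positivity),
      mul_comm, ← ENNReal.le_div_iff_mul_le (Or.inl (by simpa using hpos))
      (Or.inl ENNReal.ofReal_ne_top), ← ENNReal.ofReal_div_of_pos hpos] at key
    refine key.trans (ENNReal.ofReal_le_ofReal ?_)
    -- The factor r^n cancels against the volume of the balls of radius r/2 from Fubini, leaving the
    -- summable r^γ.
    have e1 : r ^ (q * (n : ℝ) / p) = r ^ n * r ^ γ := by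
      rw [← Real.rpow_natCast, ← Real.rpow_add hr0]
      congr 1
      rw [hγ]
      ring
    have e2 : (R * ρ ^ k) ^ γ = (v / ω) ^ (q / p - 1) * (ρ ^ γ) ^ k := by
      rw [Real.mul_rpow hR0.le (by positivity), ← hRn, ← Real.rpow_natCast R n,
        ← Real.rpow_mul hR0.le, ← Real.rpow_natCast ρ k, ← Real.rpow_natCast (ρ ^ γ) k,
        ← Real.rpow_mul hρ0.le, ← Real.rpow_mul hρ0.le, mul_comm (k : ℝ) γ]
    clear_value r
    calc _ = Q * 2 ^ n * (v / ω) * r ^ γ := by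
          rw [e1, div_pow]
          field_simp
      _ ≤ Q * 2 ^ n * (v / ω) * (R * ρ ^ k) ^ γ := by gcongr
      _ = _ := by
          rw [e2, Real.rpow_sub_one (by positivity)]
          field_simp
  calc μ K ≤ ∑' k, μ (L k) := (measure_mono hcover).trans (measure_iUnion_le _)
    _ ≤ ∑' k, ENNReal.ofReal (Q * 2 ^ n * (v / ω) ^ (q / p) * (ρ ^ γ) ^ k) :=
        ENNReal.tsum_le_tsum hlevel
    _ = ENNReal.ofReal (Q * 2 ^ n * (v / ω) ^ (q / p) * (1 - ρ ^ γ)⁻¹) := by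
        rw [← ENNReal.ofReal_tsum_of_nonneg (fun k => by positivity)
          ((summable_geometric_of_lt_one hργ0 hργ).mul_left _), tsum_mul_left,
          tsum_geometric_of_lt_one hργ0 hργ]
    _ = _ := by
        rw [hVv, ENNReal.ofReal_rpow_of_pos hv0, ← ENNReal.ofReal_mul' (by positivity),
          div_eq_mul_inv, Real.mul_rpow hv0.le (by positivity)]
        congr 1
        ring

end CaffarelliSilvestre

end

theorem mainTheorem1 (n : ℕ) (hn : 1 ≤ n) (α : ℝ) (hα0 : 0 < α) (hα2 : α < 2)
    (p q : ℝ) (hp : 1 < p) (hpq : p ≤ q)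
    (μ : MeasureTheory.Measure (CaffarelliSilvestre.UpperHalfSpace n)) [μ.Regular] :
    (CaffarelliSilvestre.Embedding α p q μ ↔
      CaffarelliSilvestre.capacityRatioSup α p q μ < ∞) ∧
    (p < q → ∀ κ : ℝ, 0 < κ →
      (CaffarelliSilvestre.Embedding α p q μ ↔
        CaffarelliSilvestre.ballRatioSup p q κ μ < ∞)) := by
  have hp0 : 0 < p := by linarith
  have hq0 : 0 < q := by linarith
  refine ⟨⟨fun h => h.capacityRatioSup_lt_top hα0 hp0 hq0, fun h => ?_⟩, fun hlt κ hκ =>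
    ⟨fun h => h.ballRatioSup_lt_top hα0 hp0 hq0 hκ, fun h => ?_⟩⟩
  · obtain ⟨A, hA, hS⟩ :=
      CaffarelliSilvestre.exists_shadowBound_of_capacityRatioSup_lt_top hα0 hp0 hq0 h
    exact hS.embedding hn hα0 hp hpq hA
  · have := CaffarelliSilvestre.sigmaFinite_of_regular μ
    obtain ⟨A, hA, hS⟩ :=
      CaffarelliSilvestre.exists_shadowBound_of_ballRatioSup_lt_top hn hp0 hlt hκ h
    exact hS.embedding hn hα0 hp hpq hA
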